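/- Let $(R,\mathfrak m,k)$ be a commutative Noetherian local ring and let $M$ and $N$ be finitely generated $R$-modules. Let $R\ltimes M$ be the idealization of $M$, that is, the commutative ring $R\oplus M$ with coordinate-wise addition and product $(r_1,m_1)(r_2,m_2)=(r_1r_2,\,r_1m_2+r_2m_1)$; it is a local ring with residue field $k$. View $N$ as an $R\ltimes M$-module through the projection $R\ltimes M\to R$. For a module $X$ over a local ring $A$ with residue field $k$, let $\beta_i^A(X)=\dim_k\operatorname{Tor}_i^A(X,k)$ denote the $i$-th Betti number (with $\beta_{-1}^A(X)=0$), and let $\operatorname{edim}(A)=\dim_k(\mathfrak n/\mathfrak n^2)$, where $\mathfrak n$ is the maximal ideal of $A$. Then: 1. $\beta_0^{R\ltimes M}(N)=\beta_0^R(N)$. 2. $\beta_1^{R\ltimes M}(N)=\beta_0^R(N)\beta_0^R(M)+\beta_1^R(N)$. In particular, $\operatorname{edim}(R\ltimes M)=\beta_0^R(M)+\operatorname{edim}(R)$. 3. $\beta_2^{R\ltimes M}(N)=\beta_0^R(N)\beta_0^R(M)^2+\beta_0^R(N)\beta_1^R(M)+\beta_0^R(M)\beta_1^R(N)+\beta_2^R(N)$.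 4. $\beta_i^{R\ltimes M}(N)\ge \beta_0^R(M)\beta_{i-1}^R(N)+\beta_i^R(N)$ for all $i\ge 0$. -/

import Mathlib

open CategoryTheory

universe u

/-- The idealization `R ⋉ M` of a module over a local ring is a local ring. -/
instance TrivSqZeroExt.instIsLocalRingIdealization (R M : Type u) [CommRing R] [IsLocalRing R]
    [AddCommGroup M] [Module R M] [Module Rᵐᵒᵖ M] [IsCentralScalar R M] :
    IsLocalRing (TrivSqZeroExt R M) :=
  IsLocalRing.of_nonunits_add fun a b ha hb => by
    simp only [mem_nonunits_iff, TrivSqZeroExt.isUnit_iff_isUnit_fst,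
      TrivSqZeroExt.fst_add] at ha hb ⊢
    exact IsLocalRing.nonunits_add ha hb

namespace LocalBetti

/-- `Tor_i^A(X, k)` for a local ring `A` with residue field `k`, as an `A`-module: the homology in
degree `i` of `P ⊗ k`, where `P` is a projective resolution of `X`. -/
noncomputable abbrev torResidue (A : Type u) [CommRing A] [IsLocalRing A] (X : ModuleCat.{u} A)
    (i : ℕ) : ModuleCat.{u} A :=
  ((Tor' (ModuleCat.{u} A) i).obj X).obj (ModuleCat.of A (IsLocalRing.ResidueField A))

/-- If the scalar `r` kills all terms of a complex of modules, it kills the homology. -/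
theorem smul_homology_eq_zero {A : Type u} [CommRing A] {ι : Type} {c : ComplexShape ι}
    (K : HomologicalComplex (ModuleCat.{u} A) c) (r : A)
    (h : ∀ j, ∀ x : K.X j, r • x = 0) (i : ι) (x : K.homology i) : r • x = 0 := by
  have h2 : r • 𝟙 (K.sc i) = 0 := by
    ext y
    · exact h _ y
    · exact h _ y
    · exact h _ y
  have h3 : r • 𝟙 (K.sc i).homology = 0 := by
    rw [← ShortComplex.homologyMap_id, ← ShortComplex.homologyMap_smul, h2,
      ShortComplex.homologyMap_zero]
  have h4 := congrArg (fun f => f.hom x) h3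
  exact h4

/-- Isomorphic modules are killed by the same scalars. -/
theorem smul_eq_zero_of_iso {A : Type u} [CommRing A] {X Y : ModuleCat.{u} A} (e : X ≅ Y) (r : A)
    (h : ∀ y : Y, r • y = 0) (x : X) : r • x = 0 := by
  apply e.toLinearEquiv.injective
  rw [map_zero, LinearEquiv.map_smul, h]

/-- The module `Tor_i^A(X, k)` is killed by the maximal ideal of `A`. -/
theorem isTorsionBySet_torResidue (A : Type u) [CommRing A] [IsLocalRing A] (X : ModuleCat.{u} A)
    (i : ℕ) : Module.IsTorsionBySet A (torResidue A X i) (IsLocalRing.maximalIdeal A) := by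
  rintro x ⟨r, hr⟩
  let k := ModuleCat.of A (IsLocalRing.ResidueField A)
  let e := (projectiveResolution X).isoLeftDerivedObj ((MonoidalCategory.tensoringRight
    (ModuleCat.{u} A)).obj k) i
  have hk : ∀ y : IsLocalRing.ResidueField A, r • y = 0 := by
    intro y
    rw [Algebra.smul_def, IsLocalRing.ResidueField.algebraMap_eq,
      (IsLocalRing.residue_eq_zero_iff r).2 hr, zero_mul]
  refine smul_eq_zero_of_iso e r (fun w => ?_) x
  refine smul_homology_eq_zero _ r (fun j z => ?_) i w
  change TensorProduct A ((projectiveResolution X).complex.X j)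
    (IsLocalRing.ResidueField A) at z
  change r • z = 0
  induction z using TensorProduct.induction_on with
  | zero => exact smul_zero r
  | tmul a b => rw [← TensorProduct.tmul_smul, hk, TensorProduct.tmul_zero]
  | add a b ha hb => rw [smul_add, ha, hb, add_zero]

/-- `Tor_i^A(X, k)` as a vector space over the residue field `k` of `A`. -/
noncomputable instance torResidueModule (A : Type u) [CommRing A] [IsLocalRing A]
    (X : ModuleCat.{u} A) (i : ℕ) :
    Module (IsLocalRing.ResidueField A) (torResidue A X i) :=
  (isTorsionBySet_torResidue A X i).module

/-- The `i`-th Betti number `β_i^A(X) = dim_k Tor_i^A(X, k)` of a module `X` over a local ring `A`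
with residue field `k`. -/
noncomputable def betti (A : Type u) [CommRing A] [IsLocalRing A] (X : ModuleCat.{u} A)
    (i : ℕ) : ℕ :=
  Module.finrank (IsLocalRing.ResidueField A) (torResidue A X i)

/-- The embedding dimension `dim_k (𝔪 / 𝔪 ^ 2)` of a local ring with maximal ideal `𝔪` and
residue field `k`. -/
noncomputable def edim (A : Type u) [CommRing A] [IsLocalRing A] : ℕ :=
  Module.finrank (IsLocalRing.ResidueField A) (IsLocalRing.CotangentSpace A)

/-- An `R`-module `N`, seen as a module over the idealization `R ⋉ M` through the projection
`R ⋉ M → R`, that is, `(r, m) • x = r • x`. -/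
noncomputable abbrev overIdealization (R M N : Type u) [CommRing R]
    [AddCommGroup M] [Module R M] [Module Rᵐᵒᵖ M] [IsCentralScalar R M]
    [AddCommGroup N] [Module R N] : ModuleCat.{u} (TrivSqZeroExt R M) :=
  (ModuleCat.restrictScalars (TrivSqZeroExt.fstHom R R M).toRingHom).obj (ModuleCat.of R N)

end LocalBetti

open LocalBetti

/-!
# Betti numbers over an idealization

If `A` is an `R`-algebra with a retraction `A → R`, then tensoring a minimal `R`-resolution of `N`
with a minimal `A`-resolution of `R` gives a minimal `A`-resolution of `N`. For `A = R ⋉ M`, whose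
ideal `M` is again an `R`-module, this determines all Betti numbers recursively.
-/

/-! Write `A = R ⋉ M` and let `P_X^B(t) = ∑ β_i^B(X) t ^ i`. The projection `A → R` is a retraction
of `R → A`. Take a minimal resolution `F` of `N` over `R` and a minimal resolution `D` of `R` over
`A`. The complex `F ⊗_R D` consists of free `A`-modules; each `F_i ⊗_R D` resolves `F_i`, since
`F_i` is free over `R`, so the total complex resolves `N`. It is again minimal, because the maximal
ideal of `R` maps into that of `A`. Counting ranks gives `P_N^A = P_N^R * P_R^A`
(`MinimalResolution.total`, `betti_idealization`).

The kernel of `A → R` is `M`, on which `A` acts through `R`. Splicing a minimal resolution of this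
ideal with `A` yields `P_R^A = 1 + t * P_M^A` (`MinimalResolution.augment`,
`betti_idealization_base`). Together, `P_N^A = P_N^R / (1 - t * P_M^R)`. The equalities are its
coefficients up to degree 2, and the inequality keeps two terms of the convolution. For the
embedding dimension take `N = k`, since `β_1(k) = edim` over a Noetherian local ring
(`edim_eq_betti`). -/

namespace LocalBetti

open IsLocalRing

/-! ### Betti numbers as ranks of a minimal free resolution -/

/-- A module over a local ring that is linearly equivalent to `k ^ ι` has dimension `card ι` over
the residue field `k`. -/
theorem finrank_residueField_eq {A : Type u} [CommRing A] [IsLocalRing A] {V : Type*}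
    [AddCommGroup V] [Module A V] [Module (ResidueField A) V] [IsScalarTower A (ResidueField A) V]
    {ι : Type*} (e : V ≃ₗ[A] (ι →₀ ResidueField A)) :
    Module.finrank (ResidueField A) V = Nat.card ι := by
  let e' := LinearEquiv.extendScalarsOfSurjective (S := ResidueField A)
    (IsLocalRing.residue_surjective (R := A)) e
  rw [e'.finrank_eq, Module.finrank_eq_nat_card_basis (Finsupp.basisSingleOne)]

/-- The Betti numbers are the ranks in a minimal free resolution. -/
theorem betti_eq_of_exact {A : Type u} [CommRing A] [IsLocalRing A] (X : ModuleCat.{u} A)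
    (C : ℕ → Type u) [∀ i, AddCommGroup (C i)] [∀ i, Module A (C i)] {ι : ℕ → Type}
    (b : ∀ i, Module.Basis (ι i) A (C i))
    (d : ∀ i, C (i + 1) →ₗ[A] C i) (ε : C 0 →ₗ[A] X) (hε : Function.Surjective ε)
    (h0 : Function.Exact (d 0) ε) (hd : ∀ i, Function.Exact (d (i + 1)) (d i))
    (hmin : ∀ i z, d i z ∈ maximalIdeal A • (⊤ : Submodule A (C i))) (i : ℕ) :
    betti A X i = Nat.card (ι i) := by
  classical
  have dd : ∀ i, ModuleCat.ofHom (d (i + 1)) ≫ ModuleCat.ofHom (d i) = 0 := fun i => by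
    ext z
    exact (hd i).apply_apply_eq_zero z
  let K : ChainComplex (ModuleCat.{u} A) ℕ :=
    ChainComplex.of (fun i => ModuleCat.of A (C i)) (fun i => ModuleCat.ofHom (d i)) dd
  have Kd : ∀ i, K.d (i + 1) i = ModuleCat.ofHom (d i) := fun i => by
    simp only [K, ChainComplex.of_d]
  have hK0 : K.d 1 0 ≫ ModuleCat.ofHom ε = 0 := by
    rw [Kd 0]
    ext z
    exact h0.apply_apply_eq_zero z
  have hproj : ∀ i, Projective (K.X i) := fun i => by
    have : Module.Projective A (C i) := .of_basis (b i)
    exact (IsProjective.iff_projective (C i)).1 this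
  let P : ProjectiveResolution X :=
    { complex := K
      projective := hproj
      π := (ChainComplex.toSingle₀Equiv _ _).symm ⟨ModuleCat.ofHom ε, hK0⟩
      quasiIso := ⟨fun n => by
        cases n with
        | zero =>
          rw [ChainComplex.quasiIsoAt₀_iff, ShortComplex.quasiIso_iff_of_zeros']
          · refine (ShortComplex.exact_and_epi_g_iff_of_iso (S₂ := ShortComplex.mk
              (ModuleCat.ofHom (d 0)) (ModuleCat.ofHom ε) (by rw [← Kd 0]; exact hK0)) ?_).2
                ⟨?_, ?_⟩
            · exact ShortComplex.isoMk (Iso.refl _) (Iso.refl _) (Iso.refl _)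
                ((Category.id_comp _).trans ((Kd 0).symm.trans (Category.comp_id _).symm))
                ((Category.id_comp _).trans (Category.comp_id _).symm)
            · rw [ShortComplex.moduleCat_exact_iff]
              intro x hx
              exact (h0 x).1 hx
            · exact (ModuleCat.epi_iff_surjective _).2 hε
          all_goals rfl
        | succ n =>
          rw [quasiIsoAt_iff_exactAt' (hL := ChainComplex.exactAt_succ_single_obj ..)]
          rw [HomologicalComplex.exactAt_iff' _ (n + 1 + 1) (n + 1) n (by simp) (by simp),
            ShortComplex.moduleCat_exact_iff]
          intro x hx
          change K.d (n + 1) n x = 0 at hx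
          change ∃ y, K.d (n + 1 + 1) (n + 1) y = x
          rw [Kd] at hx ⊢
          exact (hd n x).1 hx⟩ }
  let k := ModuleCat.of A (ResidueField A)
  let F := (MonoidalCategory.tensoringRight (ModuleCat.{u} A)).obj k
  -- Minimality: coefficients in the maximal ideal act as zero on `k`, so the resolution tensored
  -- with `k` has zero differential and is its own homology.
  have hz : ∀ i, F.map (ModuleCat.ofHom (d i)) = 0 := fun i => by
    ext z
    change TensorProduct A (C (i + 1)) (ResidueField A) at z
    change LinearMap.rTensor (ResidueField A) (d i) z = 0
    induction z using TensorProduct.induction_on with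
    | zero => simp
    | add a b ha hb => rw [map_add, ha, hb, add_zero]
    | tmul a c =>
      rw [LinearMap.rTensor_tmul]
      refine Submodule.smul_induction_on (p := fun x => x ⊗ₜ[A] c = 0) (hmin i a) ?_ ?_
      · intro r hr n _
        rw [TensorProduct.smul_tmul, Algebra.smul_def, ResidueField.algebraMap_eq,
          (residue_eq_zero_iff r).2 hr, zero_mul, TensorProduct.tmul_zero]
      · intro x y hx hy
        rw [TensorProduct.add_tmul, hx, hy, add_zero]
  let L := (F.mapHomologicalComplex (ComplexShape.down ℕ)).obj K
  have hL : ∀ i j, L.d i j = 0 := fun i j => by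
    by_cases hij : j + 1 = i
    · subst hij
      change F.map (K.d (j + 1) j) = 0
      rw [Kd]
      exact hz j
    · exact L.shape _ _ hij
  let e₁ : torResidue A X i ≅ L.homology i := P.isoLeftDerivedObj F i
  let e₂ : L.homology i ≅ L.X i :=
    (ShortComplex.HomologyData.ofZeros (L.sc i) (hL _ _) (hL _ _)).left.homologyIso
  let e₃ : (L.X i : Type u) ≃ₗ[A] TensorProduct A (C i) (ResidueField A) :=
    LinearEquiv.refl A (TensorProduct A (C i) (ResidueField A))
  let e := (e₁ ≪≫ e₂).toLinearEquiv ≪≫ₗ e₃ ≪≫ₗ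
    (TensorProduct.congr (b i).repr (LinearEquiv.refl A _)) ≪≫ₗ
      TensorProduct.finsuppScalarLeft A (ResidueField A) (ι i)
  have : IsScalarTower A (ResidueField A) (torResidue A X i) :=
    (isTorsionBySet_torResidue A X i).isScalarTower
  exact finrank_residueField_eq e

/-! ### Minimal resolutions as ungraded differential modules -/

/-- A minimal free resolution of the module `X` over a local ring `A`, as an ungraded differential
module: `κ` is a basis of all terms of the resolution together, and `deg` gives the homological
degree of each basis element. -/
structure MinimalResolution (A : Type*) [CommRing A] [IsLocalRing A] (X : Type*) [AddCommGroup X]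
    [Module A X] (κ : Type) (deg : κ → ℕ) where
  /-- The differential. -/
  d : (κ →₀ A) →ₗ[A] (κ →₀ A)
  /-- The augmentation. -/
  ε : (κ →₀ A) →ₗ[A] X
  finite_deg : ∀ i, Finite {x // deg x = i}
  deg_eq : ∀ x y, d (.single x 1) y ≠ 0 → deg x = deg y + 1
  d_mem : ∀ x y, d (.single x 1) y ∈ maximalIdeal A
  d_d : ∀ z, d (d z) = 0
  ε_d : ∀ z, ε (d z) = 0
  ε_single : ∀ x, deg x ≠ 0 → ε (.single x 1) = 0
  surjective : Function.Surjective ε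
  -- This covers every degree at once: `d` vanishes in degree 0 by `deg_eq`, and `ε` vanishes in
  -- positive degrees.
  exact : ∀ z, d z = 0 → ε z = 0 → ∃ w, d w = z

namespace MinimalResolution

variable {A : Type*} [CommRing A] [IsLocalRing A] {X : Type*} [AddCommGroup X]
    [Module A X] {κ : Type} {deg : κ → ℕ} (P : MinimalResolution A X κ deg)

theorem d_single (x : κ) (a : A) : P.d (.single x a) = a • P.d (.single x 1) := by
  rw [← map_smul, Finsupp.smul_single, smul_eq_mul, mul_one]

theorem ε_single' (x : κ) (a : A) (hx : deg x ≠ 0) : P.ε (.single x a) = 0 := by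
  rw [← mul_one a, ← smul_eq_mul, ← Finsupp.smul_single, map_smul, P.ε_single x hx, smul_zero]

theorem d_apply_mem (z : κ →₀ A) (y : κ) : P.d z y ∈ maximalIdeal A := by
  induction z using Finsupp.induction_linear with
  | zero => simp
  | add a b ha hb => rw [map_add]; exact add_mem ha hb
  | single x a =>
    rw [P.d_single]
    exact Ideal.mul_mem_left _ _ (P.d_mem x y)

/-- Homogeneity of `d`, by `deg_eq`. This recovers graded statements from ungraded ones: a preimage
can be replaced by its component of the right degree. -/
theorem d_filter (z : κ →₀ A) (i : ℕ) :
    P.d (z.filter fun x => deg x = i + 1) = (P.d z).filter fun x => deg x = i := by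
  induction z using Finsupp.induction_linear with
  | zero => simp only [Finsupp.filter_zero, map_zero]
  | add a b ha hb => rw [Finsupp.filter_add, map_add, map_add, Finsupp.filter_add, ha, hb]
  | single x a =>
    by_cases hx : deg x = i + 1
    · rw [Finsupp.filter_single_of_pos (fun x => deg x = i + 1) hx, eq_comm, Finsupp.filter_eq_self_iff]
      intro y hy
      rw [P.d_single] at hy
      have := P.deg_eq x y fun h => hy (by rw [Finsupp.smul_apply, h, smul_zero])
      omega
    · rw [Finsupp.filter_single_of_neg (fun x => deg x = i + 1) hx, map_zero, eq_comm, Finsupp.filter_eq_zero_iff]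
      intro y hy
      by_contra h
      rw [P.d_single] at h
      have := P.deg_eq x y fun h' => h (by rw [Finsupp.smul_apply, h', smul_zero])
      omega

theorem d_filter_zero (z : κ →₀ A) : P.d (z.filter fun x => deg x = 0) = 0 := by
  induction z using Finsupp.induction_linear with
  | zero => simp only [Finsupp.filter_zero, map_zero]
  | add a b ha hb => rw [Finsupp.filter_add, map_add, ha, hb, add_zero]
  | single x a =>
    by_cases hx : deg x = 0
    · rw [Finsupp.filter_single_of_pos (fun x => deg x = 0) hx, P.d_single]
      ext y
      by_contra h
      have := P.deg_eq x y fun h' => h (by rw [Finsupp.smul_apply, h', smul_zero]; rfl)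
      omega
    · rw [Finsupp.filter_single_of_neg (fun x => deg x = 0) hx, map_zero]

theorem ε_filter_zero (z : κ →₀ A) : P.ε (z.filter fun x => deg x = 0) = P.ε z := by
  induction z using Finsupp.induction_linear with
  | zero => simp only [Finsupp.filter_zero, map_zero]
  | add a b ha hb => rw [Finsupp.filter_add, map_add, ha, hb, map_add]
  | single x a =>
    by_cases hx : deg x = 0
    · rw [Finsupp.filter_single_of_pos (fun x => deg x = 0) hx]
    · rw [Finsupp.filter_single_of_neg (fun x => deg x = 0) hx, map_zero, P.ε_single' x a hx]

/-- The degree 0 part of a preimage is killed by `d` and carries all of its augmentation, so it can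
be subtracted. -/
theorem exact_of_ε (z : κ →₀ A) (hd : P.d z = 0) (hε : P.ε z = 0) :
    ∃ w, P.d w = z ∧ P.ε w = 0 := by
  obtain ⟨w, hw⟩ := P.exact z hd hε
  refine ⟨w - w.filter fun x => deg x = 0, ?_, ?_⟩
  · rw [map_sub, P.d_filter_zero, hw, sub_zero]
  · rw [map_sub, P.ε_filter_zero, sub_self]

end MinimalResolution

theorem _root_.Module.Basis.mem_ideal_smul_top {A C : Type*} [CommRing A] [AddCommGroup C]
    [Module A C] {ι : Type*} (b : Module.Basis ι A C) (I : Ideal A) (z : C)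
    (h : ∀ y, b.repr z y ∈ I) : z ∈ I • (⊤ : Submodule A C) := by
  rw [← b.linearCombination_repr z, Finsupp.linearCombination_apply]
  exact Submodule.sum_mem _ fun y _ => Submodule.smul_mem_smul (h y) Submodule.mem_top

/-- The `i`-th Betti number is the number of basis elements of degree `i` in a minimal
resolution. -/
theorem MinimalResolution.betti_eq {A : Type u} [CommRing A] [IsLocalRing A] {X : ModuleCat.{u} A}
    {κ : Type} {deg : κ → ℕ} (P : MinimalResolution A X κ deg) (i : ℕ) :
    betti A X i = Nat.card {x // deg x = i} := by
  let H : ℕ → Submodule A (κ →₀ A) := fun i => Finsupp.supported A A {x | deg x = i}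
  have hH : ∀ i (z : κ →₀ A), z ∈ H i ↔ (z.filter fun x => deg x = i) = z := fun i z => by
    rw [Finsupp.filter_eq_self_iff, Finsupp.mem_supported']
    exact forall_congr' fun x => not_imp_comm
  have hdH : ∀ i z, z ∈ H (i + 1) → P.d z ∈ H i := fun i z hz => by
    rw [hH] at hz ⊢
    rw [← P.d_filter, hz]
  refine betti_eq_of_exact X (fun i => H i) (ι := fun i => {x // deg x = i})
    (fun i => Module.Basis.ofRepr (Finsupp.supportedEquivFinsupp {x | deg x = i}))
    (fun i => P.d.restrict (hdH i)) (P.ε ∘ₗ (H 0).subtype) ?_ ?_ ?_ ?_ i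
  · intro x
    obtain ⟨z, rfl⟩ := P.surjective x
    refine ⟨⟨z.filter fun x => deg x = 0, (hH 0 _).2 ?_⟩, P.ε_filter_zero z⟩
    rw [Finsupp.filter_eq_self_iff]
    intro x hx
    by_contra h
    exact hx (Finsupp.filter_apply_neg _ _ h)
  · rintro ⟨z, hz⟩
    constructor
    · intro h
      obtain ⟨w, hw⟩ := P.exact z (by rw [← (hH 0 z).1 hz, P.d_filter_zero]) h
      -- `w` need not be homogeneous; only its degree 1 part contributes to `z`.
      refine ⟨⟨w.filter fun x => deg x = 1, (hH 1 _).2 ?_⟩, Subtype.ext ?_⟩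
      · rw [Finsupp.filter_eq_self_iff]
        intro x hx
        by_contra h
        exact hx (Finsupp.filter_apply_neg _ _ h)
      · change P.d (w.filter fun x => deg x = 0 + 1) = z
        rw [P.d_filter, hw, (hH 0 z).1 hz]
    · rintro ⟨⟨w, hw⟩, h⟩
      rw [← h]
      exact P.ε_d w
  · intro i
    rintro ⟨z, hz⟩
    constructor
    · intro h
      have h' : P.d z = 0 := congrArg Subtype.val h
      obtain ⟨w, hw⟩ := P.exact z h' (by
        rw [← P.ε_filter_zero, (Finsupp.filter_eq_zero_iff _ _).2, map_zero]
        intro x hx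
        by_contra h
        have := (Finsupp.mem_supported _ z).1 hz (Finsupp.mem_support_iff.2 h)
        exact absurd (hx.symm.trans this) (by omega))
      refine ⟨⟨w.filter fun x => deg x = i + 1 + 1, (hH _ _).2 ?_⟩, Subtype.ext ?_⟩
      · rw [Finsupp.filter_eq_self_iff]
        intro x hx
        by_contra h
        exact hx (Finsupp.filter_apply_neg _ _ h)
      · change P.d (w.filter fun x => deg x = i + 1 + 1) = z
        rw [P.d_filter, hw, (hH _ z).1 hz]
    · rintro ⟨⟨w, hw⟩, h⟩
      rw [← h]
      exact Subtype.ext (P.d_d w)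
  · intro i z
    refine Module.Basis.mem_ideal_smul_top
      (Module.Basis.ofRepr (Finsupp.supportedEquivFinsupp {x | deg x = i})) _ _ fun y => ?_
    exact P.d_apply_mem z.1 y.1

/-! ### Existence of minimal resolutions -/

/-- Every finitely generated module over a local ring has a free cover whose kernel lies in the
maximal ideal. -/
theorem exists_minimal_cover (A : Type*) [CommRing A] [IsLocalRing A] (X : Type*) [AddCommGroup X]
    [Module A X] [Module.Finite A X] :
    ∃ (n : ℕ) (f : (Fin n →₀ A) →ₗ[A] X), Function.Surjective f ∧
      ∀ z, f z = 0 → ∀ y, z y ∈ maximalIdeal A := by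
  classical
  have hex : ∃ (n : ℕ) (s : Fin n → X), Submodule.span A (Set.range s) = ⊤ :=
    Module.Finite.exists_fin
  -- With the least possible number of generators, a relation with a unit coefficient would make one
  -- generator redundant.
  obtain ⟨n, ⟨s, hs⟩, hmin⟩ : ∃ n, (∃ s : Fin n → X, Submodule.span A (Set.range s) = ⊤) ∧
      ∀ m < n, ¬ ∃ s : Fin m → X, Submodule.span A (Set.range s) = ⊤ :=
    ⟨Nat.find hex, Nat.find_spec hex, fun m => Nat.find_min hex⟩
  refine ⟨n, Finsupp.linearCombination A s, ?_, fun z hz y => ?_⟩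
  · rw [← LinearMap.range_eq_top, Finsupp.range_linearCombination, hs]
  · by_contra hy
    have hu : IsUnit (z y) := by simpa using hy
    have hsum : ∑ i, z i • s i = 0 := by
      rw [← hz, Finsupp.linearCombination_apply, Finsupp.sum_fintype _ _ (by simp)]
    obtain ⟨m, hm⟩ : ∃ m, n = m + 1 := ⟨n - 1, by have := y.pos; omega⟩
    subst hm
    refine hmin m (by omega) ⟨fun i => s (y.succAbove i), ?_⟩
    rw [eq_top_iff, ← hs, Submodule.span_le]
    rintro _ ⟨i, rfl⟩
    have hsucc : ∀ j, s (y.succAbove j) ∈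
        Submodule.span A (Set.range fun i => s (y.succAbove i)) :=
      fun j => Submodule.subset_span ⟨j, rfl⟩
    rcases Fin.eq_self_or_eq_succAbove y i with rfl | ⟨j, rfl⟩
    · rw [SetLike.mem_coe, ← Submodule.smul_mem_iff_of_isUnit _ hu]
      rw [Fin.sum_univ_succAbove _ i] at hsum
      rw [eq_neg_of_add_eq_zero_left hsum]
      exact neg_mem (sum_mem fun j _ => Submodule.smul_mem _ _ (hsucc j))
    · exact hsucc j

/-- Finitely generated modules over Noetherian local rings have minimal resolutions, in graded
form. -/
theorem exists_graded_minimalResolution (A X : Type u) [CommRing A] [IsLocalRing A]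
    [IsNoetherianRing A] [AddCommGroup X] [Module A X] [Module.Finite A X] :
    ∃ (n : ℕ → ℕ) (d : ∀ i, (Fin (n (i + 1)) →₀ A) →ₗ[A] (Fin (n i) →₀ A))
      (ε : (Fin (n 0) →₀ A) →ₗ[A] X), Function.Surjective ε ∧ Function.Exact (d 0) ε ∧
      (∀ i, Function.Exact (d (i + 1)) (d i)) ∧ ∀ i z y, d i z y ∈ maximalIdeal A := by
  let S := {Y : ModuleCat.{u} A // Module.Finite A Y}
  have hc : ∀ Y : S, ∃ (n : ℕ) (f : (Fin n →₀ A) →ₗ[A] Y.1), Function.Surjective f ∧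
      ∀ z, f z = 0 → ∀ y, z y ∈ maximalIdeal A := fun Y =>
    have := Y.2
    exists_minimal_cover A Y.1
  choose n f hf hm using hc
  -- The syzygy of a minimal cover stays finitely generated because `A` is Noetherian, so the
  -- construction iterates.
  let next : S → S := fun Y => ⟨ModuleCat.of A (LinearMap.ker (f Y)), by
    change Module.Finite A (LinearMap.ker (f Y))
    infer_instance⟩
  let T : ℕ → S := fun i => Nat.rec ⟨ModuleCat.of A X, ‹_›⟩ (fun _ Y => next Y) i
  let g : ∀ i, (Fin (n (T (i + 1))) →₀ A) →ₗ[A] LinearMap.ker (f (T i)) := fun i => f (T (i + 1))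
  have hg : ∀ i, Function.Surjective (g i) := fun i => hf (T (i + 1))
  have hex : ∀ i, Function.Exact ((LinearMap.ker (f (T i))).subtype ∘ₗ g i) (f (T i)) := by
    intro i z
    constructor
    · intro hz
      obtain ⟨w, hw⟩ := hg i ⟨z, hz⟩
      exact ⟨w, congrArg Subtype.val hw⟩
    · rintro ⟨w, rfl⟩
      exact (g i w).2
  refine ⟨fun i => n (T i), fun i => (LinearMap.ker (f (T i))).subtype ∘ₗ g i, f (T 0),
    hf (T 0), hex 0, fun i z => ?_, fun i z y => hm _ _ (g i z).2 y⟩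
  rw [← hex (i + 1) z]
  exact ⟨fun h => Subtype.ext h, fun h => congrArg Subtype.val h⟩

/-- All terms of the graded resolution are collected in one direct sum; `E i` and `S i` are the
inclusion and projection of the `i`-th summand. -/
theorem exists_minimalResolution (A X : Type u) [CommRing A] [IsLocalRing A]
    [IsNoetherianRing A] [AddCommGroup X] [Module A X] [Module.Finite A X] :
    ∃ (κ : Type) (deg : κ → ℕ), Nonempty (MinimalResolution A X κ deg) := by
  classical
  obtain ⟨n, d, ε, hε, h0, hd, hm⟩ := exists_graded_minimalResolution A X
  let κ := Σ i, Fin (n i)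
  let E : ∀ i, (Fin (n i) →₀ A) →ₗ[A] (κ →₀ A) := fun i => Finsupp.lmapDomain A A (Sigma.mk (β := fun i => Fin (n i)) i)
  let S : ∀ i, (κ →₀ A) →ₗ[A] (Fin (n i) →₀ A) := fun i =>
    Finsupp.lcomapDomain (Sigma.mk (β := fun i => Fin (n i)) i) sigma_mk_injective
  let v : κ → (κ →₀ A) := fun x => match x with
    | ⟨0, _⟩ => 0
    | ⟨i + 1, y⟩ => E i (d i (.single y 1))
  let D : (κ →₀ A) →ₗ[A] (κ →₀ A) := Finsupp.linearCombination A v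
  have hE : ∀ i (y : Fin (n i)) (a : A), E i (.single y a) = .single ⟨i, y⟩ a := fun i y a =>
    Finsupp.mapDomain_single
  have hEa : ∀ i z y, E i z ⟨i, y⟩ = z y := fun i z y =>
    Finsupp.mapDomain_apply (sigma_mk_injective (β := fun i => Fin (n i)) (i := i)) z y
  have hEn : ∀ i j z y, i ≠ j → E i z ⟨j, y⟩ = 0 := fun i j z y hij =>
    Finsupp.mapDomain_of_notMem_range z _ (by rintro ⟨w, hw⟩; exact hij (congrArg Sigma.fst hw))
  have hSE : ∀ i z, S i (E i z) = z := fun i z => by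
    ext y
    exact hEa i z y
  have hSE' : ∀ i j z, i ≠ j → S j (E i z) = 0 := fun i j z hij => by
    ext y
    exact hEn i j z y hij
  have hDE : ∀ i z, D (E (i + 1) z) = E i (d i z) := fun i z => by
    induction z using Finsupp.induction_linear with
    | zero => simp
    | add a b ha hb => simp only [map_add, ha, hb]
    | single y a =>
      rw [hE, Finsupp.linearCombination_single, ← mul_one a, ← smul_eq_mul,
        ← Finsupp.smul_single, map_smul, map_smul, smul_eq_mul, mul_one]
  have hDE0 : ∀ z, D (E 0 z) = 0 := fun z => by
    induction z using Finsupp.induction_linear with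
    | zero => simp
    | add a b ha hb => rw [map_add, map_add, ha, hb, add_zero]
    | single y a =>
      rw [hE, Finsupp.linearCombination_single, smul_zero]
  have hind : ∀ {p : (κ →₀ A) → Prop}, p 0 → (∀ a b, p a → p b → p (a + b)) →
      (∀ i z, p (E i z)) → ∀ z, p z := fun h0 ha hs z => by
    induction z using Finsupp.induction_linear with
    | zero => exact h0
    | add a b h1 h2 => exact ha a b h1 h2
    | single x a => exact hE x.1 x.2 a ▸ hs x.1 _
  have hSD : ∀ i z, S i (D z) = d i (S (i + 1) z) := fun i => by
    refine hind (by simp) (fun a b ha hb => by simp only [map_add, ha, hb]) fun j z => ?_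
    cases j with
    | zero => rw [hDE0, map_zero, hSE' 0 (i + 1) z (by omega), map_zero]
    | succ j =>
      rw [hDE]
      by_cases hij : j = i
      · subst hij
        rw [hSE, hSE]
      · rw [hSE' _ _ _ hij, hSE' _ _ _ (by omega), map_zero]
  have hsum : ∀ z : κ →₀ A, ∑ i ∈ z.splitSupport, E i (S i z) = z := fun z => by
    ext ⟨j, y⟩
    rw [Finsupp.finsetSum_apply, Finset.sum_eq_single j (fun i _ hij => hEn i j _ y hij), hEa]
    · rfl
    · intro hj
      rw [hEa]
      have : S j z = 0 := by
        by_contra h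
        exact hj ((Finsupp.mem_splitSupport_iff_nonzero z j).2 h)
      rw [this, Finsupp.zero_apply]
  refine ⟨κ, Sigma.fst, ⟨{
    d := D
    ε := ε ∘ₗ S 0
    finite_deg := fun i => Finite.of_injective (β := Fin (n i)) (fun x => x.2 ▸ x.1.2) ?_
    deg_eq := ?_
    d_mem := ?_
    d_d := ?_
    ε_d := ?_
    ε_single := ?_
    surjective := ?_
    exact := ?_ }⟩⟩
  · rintro ⟨⟨i, x⟩, rfl⟩ ⟨⟨j, y⟩, h⟩ hxy
    dsimp only at h
    subst h
    dsimp only at hxy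
    subst hxy
    rfl
  · rintro ⟨i, x⟩ ⟨j, y⟩ h
    rw [← hE] at h
    cases i with
    | zero => rw [hDE0] at h; exact absurd rfl h
    | succ i =>
      rw [hDE] at h
      by_contra hij
      exact h (hEn _ _ _ _ fun h => hij (congrArg (· + 1) h))
  · rintro ⟨i, x⟩ ⟨j, y⟩
    change (S j (D _)) y ∈ _
    rw [hSD]
    exact hm _ _ _
  · refine hind (by simp) (fun a b ha hb => by simp only [map_add, ha, hb, add_zero])
      fun j z => ?_
    obtain _ | _ | j := j
    · rw [hDE0, map_zero]
    · rw [hDE, hDE0]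
    · rw [hDE, hDE, (hd j).apply_apply_eq_zero, map_zero]
  · intro z
    rw [LinearMap.comp_apply, hSD, h0.apply_apply_eq_zero]
  · rintro ⟨i, x⟩ hi
    rw [← hE, LinearMap.comp_apply, hSE' _ _ _ hi, map_zero]
  · intro x
    obtain ⟨z, rfl⟩ := hε x
    exact ⟨E 0 z, by rw [LinearMap.comp_apply, hSE]⟩
  · intro z hz hεz
    have hw : ∀ i, ∃ w, d i w = S i z := fun i => by
      cases i with
      | zero => exact (h0 _).1 hεz
      | succ i => exact (hd i _).1 (by rw [← hSD, hz, map_zero])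
    choose w hw using hw
    -- Preimages are taken degree by degree and placed one degree higher; only finitely many
    -- components of `z` are nonzero.
    refine ⟨∑ i ∈ z.splitSupport, E (i + 1) (w i), ?_⟩
    simp only [map_sum, hDE, hw, hsum]

/-! ### Counting pairs, and pure tensors in a free module on a product -/

/-- The number of pairs of total degree `i` is a convolution. -/
theorem card_prod_deg {κ τ : Type} (p : κ → ℕ) (q : τ → ℕ) (hp : ∀ i, Finite {x // p x = i})
    (hq : ∀ i, Finite {y // q y = i}) (i : ℕ) :
    Finite {z : κ × τ // p z.1 + q z.2 = i} ∧
    Nat.card {z : κ × τ // p z.1 + q z.2 = i} =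
      ∑ j ∈ Finset.HasAntidiagonal.antidiagonal i, Nat.card {x // p x = j.1} * Nat.card {y // q y = j.2} := by
  let e : {z : κ × τ // p z.1 + q z.2 = i} ≃
      Σ j : Finset.HasAntidiagonal.antidiagonal i, {x // p x = j.1.1} × {y // q y = j.1.2} :=
    { toFun := fun z => ⟨⟨(p z.1.1, q z.1.2), Finset.HasAntidiagonal.mem_antidiagonal.2 z.2⟩,
        ⟨z.1.1, rfl⟩, ⟨z.1.2, rfl⟩⟩
      invFun := fun j => ⟨(j.2.1.1, j.2.2.1), by
        rw [j.2.1.2, j.2.2.2]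
        exact Finset.HasAntidiagonal.mem_antidiagonal.1 j.1.2⟩
      left_inv := fun z => rfl
      right_inv := by
        rintro ⟨⟨⟨a, b⟩, h⟩, ⟨x, hx⟩, ⟨y, hy⟩⟩
        dsimp only at hx hy
        subst hx hy
        rfl }
  refine ⟨Finite.of_equiv _ e.symm, ?_⟩
  -- Finiteness of the fibres is needed here: `Nat.card` is 0 on infinite types, hence not additive
  -- without it.
  rw [Nat.card_congr e, Nat.card_sigma]
  simp only [Nat.card_prod]
  exact Finset.sum_coe_sort (Finset.HasAntidiagonal.antidiagonal i)
    (fun j => Nat.card {x // p x = j.1} * Nat.card {y // q y = j.2})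

section Outer

variable (R A : Type*) [CommRing R] [CommRing A] [Algebra R A] (κ τ : Type)

/-- The bilinear map `f ⊗ v` from `R ^ κ` and `A ^ τ` to `A ^ (κ × τ)`. -/
noncomputable def outer : (κ →₀ R) →ₗ[R] (τ →₀ A) →ₗ[A] (κ × τ →₀ A) :=
  Finsupp.linearCombination R fun x => Finsupp.lmapDomain A A (Prod.mk x)

/-- The coordinate at `x` of an element of `A ^ (κ × τ)`, in `A ^ τ`. -/
noncomputable def slice (x : κ) : (κ × τ →₀ A) →ₗ[A] (τ →₀ A) :=
  Finsupp.lcomapDomain (Prod.mk x) (Prod.mk_right_injective x)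

variable {R A κ τ}

theorem slice_apply (x : κ) (z : κ × τ →₀ A) (y : τ) : slice A κ τ x z y = z (x, y) := rfl

theorem outer_single (x : κ) (r : R) (v : τ →₀ A) :
    outer R A κ τ (.single x r) v = r • Finsupp.mapDomain (Prod.mk x) v := by
  rw [outer, Finsupp.linearCombination_single]
  rfl

theorem outer_apply (f : κ →₀ R) (v : τ →₀ A) (x : κ) (y : τ) :
    outer R A κ τ f v (x, y) = f x • v y := by
  induction f using Finsupp.induction_linear with
  | zero => simp
  | add f g hf hg =>
    rw [map_add, LinearMap.add_apply, Finsupp.add_apply, hf, hg, Finsupp.add_apply, add_smul]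
  | single x' r =>
    rw [outer_single, Finsupp.smul_apply]
    by_cases h : x' = x
    · subst h
      rw [Finsupp.mapDomain_apply (Prod.mk_right_injective x'), Finsupp.single_eq_same]
    · rw [Finsupp.mapDomain_of_notMem_range _ _ (by rintro ⟨w, hw⟩; exact h (congrArg Prod.fst hw)),
        Finsupp.single_eq_of_ne (Ne.symm h), smul_zero, zero_smul]

theorem slice_outer (f : κ →₀ R) (v : τ →₀ A) (x : κ) :
    slice A κ τ x (outer R A κ τ f v) = f x • v := by
  ext y
  exact outer_apply f v x y

theorem outer_single_single (x : κ) (y : τ) (a : A) :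
    outer R A κ τ (.single x 1) (.single y a) = .single (x, y) a := by
  rw [outer_single, one_smul, Finsupp.mapDomain_single]

theorem sum_outer_slice [DecidableEq κ] (z : κ × τ →₀ A) :
    ∑ x ∈ z.support.image Prod.fst, outer R A κ τ (.single x 1) (slice A κ τ x z) = z := by
  ext ⟨x, y⟩
  rw [Finsupp.finsetSum_apply, Finset.sum_eq_single x]
  · rw [outer_apply, Finsupp.single_eq_same, one_smul, slice_apply]
  · intro x' _ h
    rw [outer_apply, Finsupp.single_eq_of_ne (Ne.symm h), zero_smul]
  · intro h
    rw [outer_apply, Finsupp.single_eq_same, one_smul, slice_apply]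
    by_contra hz
    exact h (Finset.mem_image.2 ⟨(x, y), Finsupp.mem_support_iff.2 hz, rfl⟩)

variable (R) in
@[elab_as_elim]
theorem outer_induction {p : (κ × τ →₀ A) → Prop}
    (h0 : p 0) (ha : ∀ a b, p a → p b → p (a + b))
    (hs : ∀ x v, p (outer R A κ τ (.single x 1) v)) (z : κ × τ →₀ A) : p z := by
  induction z using Finsupp.induction_linear with
  | zero => exact h0
  | add a b h1 h2 => exact ha a b h1 h2
  | single x a => exact outer_single_single (R := R) x.1 x.2 a ▸ hs x.1 _

/-- The sign involution of a graded free module. -/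
noncomputable def signed (R : Type*) [CommRing R] {κ : Type} (p : κ → ℕ) : (κ →₀ R) →ₗ[R] (κ →₀ R) :=
  Finsupp.linearCombination R fun x => .single x ((-1) ^ p x)

theorem signed_apply (p : κ → ℕ) (f : κ →₀ R) (x : κ) : signed R p f x = (-1) ^ p x * f x := by
  induction f using Finsupp.induction_linear with
  | zero => simp
  | add f g hf hg => rw [map_add, Finsupp.add_apply, hf, hg, Finsupp.add_apply, mul_add]
  | single x' r =>
    rw [signed, Finsupp.linearCombination_single, Finsupp.smul_apply, smul_eq_mul]
    by_cases h : x' = x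
    · subst h
      rw [Finsupp.single_eq_same, Finsupp.single_eq_same, mul_comm]
    · rw [Finsupp.single_eq_of_ne (Ne.symm h), Finsupp.single_eq_of_ne (Ne.symm h), mul_zero,
        mul_zero]

theorem outer_signed_single (p : κ → ℕ) (x : κ) (v : τ →₀ A) :
    outer R A κ τ (signed R p (.single x 1)) v =
      (-1 : A) ^ p x • outer R A κ τ (.single x 1) v := by
  ext ⟨x', y⟩
  rw [Finsupp.smul_apply, outer_apply, outer_apply, signed_apply]
  by_cases h : x = x'
  · subst h
    rw [Finsupp.single_eq_same, one_smul, mul_one, Algebra.smul_def, map_pow, map_neg, map_one,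
      smul_eq_mul]
  · rw [Finsupp.single_eq_of_ne (Ne.symm h), mul_zero, zero_smul, smul_zero]

end Outer

/-! ### The tensor product of two minimal resolutions -/

namespace MinimalResolution

variable {R A : Type*} [CommRing R] [IsLocalRing R] [CommRing A] [IsLocalRing A] [Algebra R A]
  {ρ : A →+* R} (hρ : ∀ r, ρ (algebraMap R A r) = r)
  [Module A R] (hR : ∀ (a : A) (r : R), a • r = ρ a * r)
  {N : Type*} [AddCommGroup N] [Module R N]
  {κ τ : Type} {p : κ → ℕ} {q : τ → ℕ}
  (F : MinimalResolution R N κ p) (D : MinimalResolution A R τ q)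

/-- The differential of the total complex of `F ⊗ D`. -/
noncomputable def totalD : (κ × τ →₀ A) →ₗ[A] (κ × τ →₀ A) :=
  Finsupp.linearCombination A fun z => outer R A κ τ (F.d (.single z.1 1)) (.single z.2 1) +
    (-1 : A) ^ p z.1 • outer R A κ τ (.single z.1 1) (D.d (.single z.2 1))

theorem totalD_outer_single (x : κ) (v : τ →₀ A) :
    totalD F D (outer R A κ τ (.single x 1) v) = outer R A κ τ (F.d (.single x 1)) v +
      (-1 : A) ^ p x • outer R A κ τ (.single x 1) (D.d v) := by
  induction v using Finsupp.induction_linear with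
  | zero => simp
  | add a b ha hb => simp only [map_add, ha, hb, smul_add]; abel
  | single y a =>
    rw [outer_single_single, totalD, Finsupp.linearCombination_single, D.d_single y a, smul_add,
      map_smul, smul_comm a, ← map_smul, Finsupp.smul_single, smul_eq_mul, mul_one]

/-- `F.d` lowers the degree by one and so anticommutes with the sign. This cancels the mixed terms
in the square of `totalD`. -/
theorem signed_d_single (x : κ) :
    signed R p (F.d (.single x 1)) = - F.d (signed R p (.single x 1)) := by
  rw [signed, Finsupp.linearCombination_single, one_smul, F.d_single x ((-1) ^ p x)]
  ext y
  rw [← signed, signed_apply, Finsupp.neg_apply, Finsupp.smul_apply, smul_eq_mul]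
  by_cases h : F.d (.single x 1) y = 0
  · rw [h, mul_zero, mul_zero, neg_zero]
  · rw [F.deg_eq x y h, pow_succ]
    ring

theorem totalD_outer (f : κ →₀ R) (v : τ →₀ A) :
    totalD F D (outer R A κ τ f v) = outer R A κ τ (F.d f) v +
      outer R A κ τ (signed R p f) (D.d v) := by
  induction f using Finsupp.induction_linear with
  | zero => simp
  | add f g hf hg => simp only [map_add, LinearMap.add_apply, hf, hg]; abel
  | single x r =>
    have h : (Finsupp.single x r : κ →₀ R) = r • .single x 1 := by
      rw [Finsupp.smul_single, smul_eq_mul, mul_one]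
    rw [h]
    simp only [map_smul, LinearMap.smul_apply]
    rw [← smul_add, outer_signed_single, ← totalD_outer_single, ← algebraMap_smul A, map_smul,
      algebraMap_smul]

theorem totalD_totalD (z : κ × τ →₀ A) : totalD F D (totalD F D z) = 0 := by
  refine outer_induction R ?_ (fun a b ha hb => ?_) (fun x v => ?_) z
  · simp only [map_zero]
  · rw [map_add, map_add, ha, hb, add_zero]
  · rw [totalD_outer, map_add, totalD_outer, totalD_outer, D.d_d, F.d_d, signed_d_single]
    simp

/-- The projection of the total complex of `F ⊗ D` to `F`, induced by the augmentation of `D`. -/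
noncomputable def totalπ : (κ × τ →₀ A) →ₗ[A] (κ →₀ R) :=
  Finsupp.linearCombination A fun z => .single z.1 (D.ε (.single z.2 1))

include hρ hR in
omit [IsLocalRing R] in
theorem totalπ_outer (f : κ →₀ R) (v : τ →₀ A) :
    totalπ (κ := κ) D (outer R A κ τ f v) = D.ε v • f := by
  have h1 : ∀ x, totalπ (κ := κ) D (outer R A κ τ (.single x 1) v) = .single x (D.ε v) := by
    intro x
    induction v using Finsupp.induction_linear with
    | zero => simp
    | add a b ha hb => simp only [map_add, ha, hb, Finsupp.single_add]
    | single y a =>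
      rw [outer_single_single, totalπ, Finsupp.linearCombination_single, Finsupp.smul_single,
        ← map_smul, Finsupp.smul_single, smul_eq_mul, mul_one]
  induction f using Finsupp.induction_linear with
  | zero => simp
  | add f g hf hg => rw [map_add, LinearMap.add_apply, map_add, hf, hg, smul_add]
  | single x r =>
    have h : (Finsupp.single x r : κ →₀ R) = r • .single x 1 := by
      rw [Finsupp.smul_single, smul_eq_mul, mul_one]
    rw [h, map_smul, LinearMap.smul_apply, ← algebraMap_smul A, map_smul, h1,
      Finsupp.smul_single, hR, hρ, Finsupp.smul_single, Finsupp.smul_single, smul_eq_mul,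
      smul_eq_mul, mul_one, mul_comm]

include hρ hR

theorem totalπ_totalD (z : κ × τ →₀ A) :
    totalπ D (totalD F D z) = F.d (totalπ D z) := by
  refine outer_induction R ?_ (fun a b ha hb => ?_) (fun x v => ?_) z
  · simp only [map_zero]
  · simp only [map_add, ha, hb]
  · rw [totalD_outer, map_add, totalπ_outer hρ hR, totalπ_outer hρ hR, totalπ_outer hρ hR, D.ε_d,
      zero_smul, add_zero, map_smul]

omit [IsLocalRing R] in
theorem totalπ_apply (z : κ × τ →₀ A) (x : κ) :
    totalπ D z x = D.ε (slice A κ τ x z) := by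
  refine outer_induction R ?_ (fun a b ha hb => ?_) (fun x' v => ?_) z
  · simp only [map_zero, Finsupp.zero_apply]
  · simp only [map_add, ha, hb, Finsupp.add_apply]
  · rw [totalπ_outer hρ hR, slice_outer, Finsupp.smul_apply, ← algebraMap_smul A _ v, map_smul, hR,
      hρ, smul_eq_mul, mul_comm]

omit hρ hR

/-- The `F`-part of the differential reaches row `x` only from rows one `F`-degree higher; if these
are empty, only the `D`-part is left. -/
theorem slice_totalD (z : κ × τ →₀ A) (x : κ)
    (h : ∀ x', p x' = p x + 1 → slice A κ τ x' z = 0) :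
    slice A κ τ x (totalD F D z) = (-1 : A) ^ p x • D.d (slice A κ τ x z) := by
  classical
  conv_lhs => rw [← sum_outer_slice (R := R) z]
  conv_rhs => rw [← sum_outer_slice (R := R) z]
  simp only [map_sum, Finset.smul_sum]
  refine Finset.sum_congr rfl fun x' _ => ?_
  rw [totalD_outer_single, map_add, map_smul, slice_outer, slice_outer, slice_outer]
  have h1 : F.d (.single x' 1) x • slice A κ τ x' z = 0 := by
    by_cases h0 : F.d (.single x' 1) x = 0
    · rw [h0, zero_smul]
    · rw [h x' (F.deg_eq _ _ h0), smul_zero]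
  rw [h1, zero_add]
  by_cases hx : x' = x
  · subst hx
    rw [Finsupp.single_eq_same, one_smul, one_smul]
  · rw [Finsupp.single_eq_of_ne (Ne.symm hx), zero_smul, zero_smul, map_zero, smul_zero,
      smul_zero]

include hρ hR

/-- The kernel of `totalπ` is acyclic, by induction on a bound for the `F`-degree. The rows of top
degree are `D`-cycles with zero augmentation, hence boundaries; subtracting a total boundary clears
them. -/
theorem exists_totalD_of_slice (n : ℕ) : ∀ z : κ × τ →₀ A,
    (∀ x, n ≤ p x → slice A κ τ x z = 0) → totalD F D z = 0 → totalπ D z = 0 →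
      ∃ w, totalD F D w = z := by
  classical
  induction n with
  | zero =>
    intro z hz _ _
    refine ⟨0, ?_⟩
    rw [map_zero, ← sum_outer_slice (R := R) z, eq_comm]
    exact Finset.sum_eq_zero fun x _ => by rw [hz x (Nat.zero_le _), map_zero]
  | succ n ih =>
    intro z hz hd hπ
    -- `D.ε w = 0` keeps the correction inside the kernel of `totalπ`. The last clause confines it
    -- to finitely many rows, all of `F`-degree `n`.
    have hw : ∀ x, ∃ w, D.ε w = 0 ∧ (n ≤ p x → D.d w = slice A κ τ x z) ∧
        (slice A κ τ x z = 0 ∨ p x ≠ n → w = 0) := by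
      intro x
      by_cases hx : slice A κ τ x z = 0 ∨ p x ≠ n
      · refine ⟨0, map_zero _, fun h => ?_, fun _ => rfl⟩
        rw [map_zero, eq_comm]
        exact hx.elim id fun h' => hz x (by omega)
      · have hxn : p x = n := by tauto
        have h1 := slice_totalD F D z x fun x' hx' => hz x' (by omega)
        rw [hd, map_zero, eq_comm] at h1
        have h2 : D.d (slice A κ τ x z) = 0 := by
          have := congrArg (fun v => (-1 : A) ^ p x • v) h1
          rwa [smul_smul, ← mul_pow, neg_one_mul, neg_neg, one_pow, one_smul, smul_zero] at this
        obtain ⟨w, hw, hw'⟩ := D.exact_of_ε _ h2 (by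
          rw [← totalπ_apply hρ hR, hπ, Finsupp.zero_apply])
        exact ⟨w, hw', fun _ => hw, fun h => absurd h hx⟩
    choose w hε hw hw0 using hw
    -- The sign cancels the one in `slice_totalD`.
    let W : κ × τ →₀ A := ∑ x ∈ z.support.image Prod.fst,
      outer R A κ τ (.single x 1) ((-1 : A) ^ p x • w x)
    have hW : ∀ x, slice A κ τ x W = (-1 : A) ^ p x • w x := by
      intro x
      simp only [W, map_sum, slice_outer]
      rw [Finset.sum_eq_single x]
      · rw [Finsupp.single_eq_same, one_smul]
      · intro x' _ h
        rw [Finsupp.single_eq_of_ne (Ne.symm h), zero_smul]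
      · intro h
        rw [hw0 x, smul_zero, smul_zero]
        left
        ext y
        by_contra h'
        exact h (Finset.mem_image.2 ⟨(x, y), Finsupp.mem_support_iff.2 h', rfl⟩)
    have hWπ : totalπ D W = 0 := by
      ext x
      rw [totalπ_apply hρ hR, hW, map_smul, hε, smul_zero, Finsupp.zero_apply]
    obtain ⟨w', hw'⟩ := ih (z - totalD F D W) (fun x hx => by
        rw [map_sub, slice_totalD F D W x, hW, map_smul, hw x hx, smul_smul, ← mul_pow,
          neg_one_mul, neg_neg, one_pow, one_smul, sub_self]
        intro x' hx'
        rw [hW, hw0 x' (Or.inr (by omega)), smul_zero])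
      (by rw [map_sub, hd, totalD_totalD, sub_zero])
      (by rw [map_sub, hπ, totalπ_totalD hρ hR, hWπ, map_zero, sub_zero])
    exact ⟨w' + W, by rw [map_add, hw', sub_add_cancel]⟩

/-- The image of `z` in `F` bounds some `f`. Lifting `f` to `f ⊗ v` with `D.ε v = 1` and subtracting
its total differential moves `z` into the kernel of `totalπ`. -/
theorem exists_totalD (z : κ × τ →₀ A) (hd : totalD F D z = 0) (hε : F.ε (totalπ D z) = 0) :
    ∃ w, totalD F D w = z := by
  classical
  obtain ⟨f, hf⟩ := F.exact (totalπ D z) (by rw [← totalπ_totalD hρ hR, hd, map_zero]) hε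
  obtain ⟨v, hv⟩ := D.surjective 1
  have hc : totalπ D (outer R A κ τ f v) = f := by
    rw [totalπ_outer hρ hR, hv, one_smul]
  set z' := z - totalD F D (outer R A κ τ f v) with hz'
  obtain ⟨w, hw⟩ := exists_totalD_of_slice hρ hR F D
    ((z'.support.image fun x => p x.1).sup id + 1) z' (fun x hx => by
      ext y
      by_contra h
      have : p x ≤ (z'.support.image fun x => p x.1).sup id :=
        Finset.le_sup (f := id) (Finset.mem_image.2 ⟨(x, y), Finsupp.mem_support_iff.2 h, rfl⟩)
      omega)
    (by rw [hz', map_sub, hd, totalD_totalD, sub_zero])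
    (by rw [hz', map_sub, totalπ_totalD hρ hR, hc, hf, sub_self])
  exact ⟨w + outer R A κ τ f v, by rw [map_add, hw, hz', sub_add_cancel]⟩

/-- Let `A` be an `R`-algebra with a retraction `ρ : A → R`. If `F` is a minimal resolution of `N`
over `R` and `D` is a minimal resolution of `R` over `A`, then `F ⊗_R D` is a minimal resolution
of `N` over `A`. -/
noncomputable def total [Module A N] (hN : ∀ (a : A) (n : N), a • n = ρ a • n) :
    MinimalResolution A N (κ × τ) (fun z => p z.1 + q z.2) where
  d := totalD F D
  ε :=
    { toFun := fun z => F.ε (totalπ D z)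
      map_add' := fun a b => by rw [map_add, map_add]
      map_smul' := fun a z => by
        have : a • totalπ D z = ρ a • totalπ D z := by
          ext x
          exact hR _ _
        rw [map_smul, this, map_smul, RingHom.id_apply, hN] }
  finite_deg i := (card_prod_deg p q F.finite_deg D.finite_deg i).1
  deg_eq := by
    rintro ⟨x, y⟩ ⟨x', y'⟩ h
    rw [← outer_single_single (R := R), totalD_outer_single, Finsupp.add_apply, outer_apply,
      Finsupp.smul_apply, outer_apply] at h
    dsimp only
    by_cases hy : y = y'
    · by_cases hx : x = x'
      · subst hx hy
        have h1 : F.d (.single x 1) x = 0 := by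
          by_contra h'
          have := F.deg_eq _ _ h'
          omega
        have h2 : D.d (.single y 1) y = 0 := by
          by_contra h'
          have := D.deg_eq _ _ h'
          omega
        rw [h1, h2, zero_smul, smul_zero, smul_zero, add_zero] at h
        exact absurd rfl h
      · subst hy
        rw [Finsupp.single_eq_of_ne (Ne.symm hx), zero_smul, smul_zero, add_zero] at h
        have := F.deg_eq x x' fun h' => h (by rw [h', zero_smul])
        omega
    · rw [Finsupp.single_eq_of_ne (a := y) (Ne.symm hy), smul_zero, zero_add] at h
      by_cases hx : x = x'
      · subst hx
        have := D.deg_eq y y' fun h' => h (by rw [h', smul_zero, smul_zero])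
        omega
      · rw [Finsupp.single_eq_of_ne (Ne.symm hx), zero_smul, smul_zero] at h
        exact absurd rfl h
  d_mem := by
    rintro ⟨x, y⟩ ⟨x', y'⟩
    rw [← outer_single_single (R := R), totalD_outer_single, Finsupp.add_apply, outer_apply,
      Finsupp.smul_apply, outer_apply]
    refine add_mem ?_ (Ideal.mul_mem_left _ _ ?_)
    · rw [Algebra.smul_def]
      refine Ideal.mul_mem_right _ _ ?_
      -- A nonunit of `R` stays a nonunit in `A`, since the retraction `ρ` would carry an inverse
      -- back to `R`.
      rw [mem_maximalIdeal, mem_nonunits_iff]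
      intro hu
      have := hu.map ρ
      rw [hρ] at this
      exact (mem_nonunits_iff.1 (F.d_mem x x')) this
    · rw [Algebra.smul_def]
      exact Ideal.mul_mem_left _ _ (D.d_mem y y')
  d_d := totalD_totalD F D
  ε_d z := by
    change F.ε (totalπ D (totalD F D z)) = 0
    rw [totalπ_totalD hρ hR, F.ε_d]
  ε_single := by
    rintro ⟨x, y⟩ h
    change F.ε (totalπ D _) = 0
    rw [← outer_single_single (R := R), totalπ_outer hρ hR]
    by_cases hy : q y = 0
    · have : D.ε (.single y 1) • (Finsupp.single x 1 : κ →₀ R) =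
          Finsupp.single x (D.ε (.single y 1)) := by
        rw [Finsupp.smul_single, smul_eq_mul, mul_one]
      rw [this]
      exact F.ε_single' _ _ (by dsimp only at h; omega)
    · rw [D.ε_single y hy, zero_smul, map_zero]
  surjective n := by
    obtain ⟨f, rfl⟩ := F.surjective n
    obtain ⟨v, hv⟩ := D.surjective 1
    refine ⟨outer R A κ τ f v, ?_⟩
    change F.ε (totalπ D _) = _
    rw [totalπ_outer hρ hR, hv, one_smul]
  exact := exists_totalD hρ hR F D

end MinimalResolution

/-! ### From a resolution of an ideal to one of the quotient -/

theorem _root_.Finsupp.mapDomain_some_add_single_none {A κ : Type*} [CommRing A]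
    (z : Option κ →₀ A) :
    z.some.mapDomain some + .single none (z none) = z := by
  ext o
  cases o with
  | none =>
    rw [Finsupp.add_apply, Finsupp.single_eq_same, Finsupp.mapDomain_of_notMem_range _ _ (by simp),
      zero_add]
  | some x =>
    rw [Finsupp.add_apply, Finsupp.mapDomain_apply (Option.some_injective κ),
      Finsupp.single_eq_of_ne (by simp), add_zero, Finsupp.some_apply]

namespace MinimalResolution

section Augment

variable {A : Type*} [CommRing A] [IsLocalRing A] {X : Type*} [AddCommGroup X] [Module A X]
  {κ : Type} {deg : κ → ℕ} (P : MinimalResolution A X κ deg)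

/-- The differential of the resolution of `A / X` obtained from a resolution of an ideal `X`. -/
noncomputable def augmentD (j : X →ₗ[A] A) : (Option κ →₀ A) →ₗ[A] (Option κ →₀ A) :=
  Finsupp.linearCombination A fun o => match o with
    | none => 0
    | some x => Finsupp.mapDomain some (P.d (.single x 1)) +
        .single none (j (P.ε (.single x 1)))

theorem augmentD_mapDomain (j : X →ₗ[A] A) (v : κ →₀ A) :
    P.augmentD j (v.mapDomain some) = (P.d v).mapDomain some + .single none (j (P.ε v)) := by
  induction v using Finsupp.induction_linear with
  | zero => simp
  | add a b ha hb =>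
    simp only [Finsupp.mapDomain_add, map_add, ha, hb, Finsupp.single_add]
    abel
  | single x a =>
    have h : (Finsupp.single x a : κ →₀ A) = a • .single x 1 := by
      rw [Finsupp.smul_single, smul_eq_mul, mul_one]
    rw [Finsupp.mapDomain_single, augmentD, Finsupp.linearCombination_single, h]
    simp only [map_smul, Finsupp.mapDomain_smul, smul_add]
    rw [Finsupp.smul_single]

theorem augmentD_none (j : X →ₗ[A] A) (a : A) : P.augmentD j (.single none a) = 0 := by
  rw [augmentD, Finsupp.linearCombination_single, smul_zero]

theorem augmentD_eq (j : X →ₗ[A] A) (z : Option κ →₀ A) :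
    P.augmentD j z = (P.d z.some).mapDomain some + .single none (j (P.ε z.some)) := by
  conv_lhs => rw [← Finsupp.mapDomain_some_add_single_none z]
  rw [map_add, augmentD_none, add_zero, augmentD_mapDomain]

theorem some_augmentD (j : X →ₗ[A] A) (z : Option κ →₀ A) :
    (P.augmentD j z).some = P.d z.some := by
  ext x
  rw [augmentD_eq, Finsupp.some_apply, Finsupp.add_apply,
    Finsupp.mapDomain_apply (Option.some_injective κ), Finsupp.single_eq_of_ne (by simp), add_zero]

theorem augmentD_apply_none (j : X →ₗ[A] A) (z : Option κ →₀ A) :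
    P.augmentD j z none = j (P.ε z.some) := by
  rw [augmentD_eq, Finsupp.add_apply, Finsupp.single_eq_same,
    Finsupp.mapDomain_of_notMem_range _ _ (by simp), zero_add]

/-- A minimal resolution of an ideal `X` of `A` gives a minimal resolution of `A / X`. -/
noncomputable def augment {Y : Type*} [AddCommGroup Y] [Module A Y] (j : X →ₗ[A] A)
    (hj : Function.Injective j) (hmem : ∀ x, j x ∈ maximalIdeal A) (π : A →ₗ[A] Y)
    (hπ : Function.Surjective π) (hex : Function.Exact j π) :
    MinimalResolution A Y (Option κ) (fun o => o.elim 0 fun x => deg x + 1) where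
  d := P.augmentD j
  ε := π ∘ₗ Finsupp.lapply none
  finite_deg i := by
    cases i with
    | zero =>
      have : Subsingleton {o : Option κ // (o.elim 0 fun x => deg x + 1) = 0} := ⟨by
        rintro ⟨_ | x, hx⟩ ⟨_ | y, hy⟩
        · rfl
        all_goals simp at hx hy⟩
      exact Finite.of_subsingleton
    | succ i =>
      have := P.finite_deg i
      refine Finite.of_surjective
        (fun x : {x // deg x = i} => ⟨some x.1, congrArg (· + 1) x.2⟩) ?_
      rintro ⟨_ | x, hx⟩
      · simp at hx
      · exact ⟨⟨x, by simpa using hx⟩, rfl⟩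
  deg_eq := by
    rintro (_ | x) y h
    · rw [augmentD_none] at h
      exact absurd rfl h
    · cases y with
      | none =>
        by_contra hx
        rw [augmentD_apply_none, Finsupp.some_single_some, P.ε_single, map_zero] at h
        · exact h rfl
        · simpa using hx
      | some y =>
        rw [← Finsupp.some_apply, some_augmentD, Finsupp.some_single_some] at h
        exact congrArg (· + 1) (P.deg_eq x y h)
  d_mem := by
    rintro x (_ | y)
    · rw [augmentD_apply_none]
      exact hmem _
    · rw [← Finsupp.some_apply, some_augmentD]
      exact P.d_apply_mem _ _
  d_d z := by
    rw [augmentD_eq, some_augmentD, P.d_d, P.ε_d, map_zero, Finsupp.single_zero,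
      Finsupp.mapDomain_zero, add_zero]
  ε_d z := by
    rw [LinearMap.comp_apply, Finsupp.lapply_apply, augmentD_apply_none, hex.apply_apply_eq_zero]
  ε_single := by
    rintro (_ | x) hx
    · exact absurd rfl hx
    · rw [LinearMap.comp_apply, Finsupp.lapply_apply, Finsupp.single_eq_of_ne (by simp), map_zero]
  surjective y := by
    obtain ⟨a, rfl⟩ := hπ y
    exact ⟨.single none a, by
      rw [LinearMap.comp_apply, Finsupp.lapply_apply, Finsupp.single_eq_same]⟩
  exact z hd hε := by
    obtain ⟨x, hx⟩ := (hex _).1 hε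
    obtain ⟨u, rfl⟩ := P.surjective x
    obtain ⟨w, hw, hw'⟩ := P.exact_of_ε z.some
      (by rw [← some_augmentD P j, hd, Finsupp.some_zero])
      (hj (by rw [← augmentD_apply_none, hd, map_zero]; rfl))
    -- `w` produces the coordinates of `z` on `κ` and contributes nothing at `none`; the degree 0
    -- part of `u` produces the coordinate at `none` and is killed by `P.d`.
    refine ⟨(w + u.filter fun x => deg x = 0).mapDomain some, ?_⟩
    rw [augmentD_mapDomain, map_add, map_add, hw, hw', P.d_filter_zero, P.ε_filter_zero, add_zero,
      zero_add, hx]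
    exact Finsupp.mapDomain_some_add_single_none z

theorem card_augment_zero (deg : κ → ℕ) :
    Nat.card {o : Option κ // (o.elim 0 fun x => deg x + 1) = 0} = 1 := by
  rw [Nat.card_eq_one_iff_unique]
  refine ⟨⟨?_⟩, ⟨⟨none, rfl⟩⟩⟩
  rintro ⟨_ | x, hx⟩ ⟨_ | y, hy⟩
  · rfl
  all_goals simp at hx hy

theorem card_augment_succ (deg : κ → ℕ) (i : ℕ) :
    Nat.card {o : Option κ // (o.elim 0 fun x => deg x + 1) = i + 1} =
      Nat.card {x // deg x = i} := by
  refine (Nat.card_congr (Equiv.ofBijective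
    (fun x : {x // deg x = i} => ⟨some x.1, congrArg (· + 1) x.2⟩) ⟨?_, ?_⟩)).symm
  · intro x y h
    exact Subtype.ext (Option.some_injective _ (congrArg Subtype.val h))
  · rintro ⟨_ | x, hx⟩
    · simp at hx
    · exact ⟨⟨x, by simpa using hx⟩, rfl⟩

end Augment

/-! ### The embedding dimension -/

variable {A : Type u} [CommRing A] [IsLocalRing A]

/-- Both `𝔪 / 𝔪 ^ 2` and the `k`-space on the degree 0 basis are quotients of the free module, by
the same kernel. -/
theorem edim_eq {κ : Type} {deg : κ → ℕ} (P : MinimalResolution A (maximalIdeal A) κ deg) :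
    edim A = Nat.card {x // deg x = 0} := by
  let g : (κ →₀ A) →ₗ[A] CotangentSpace A := (maximalIdeal A).toCotangent ∘ₗ P.ε
  let h : (κ →₀ A) →ₗ[A] ({x // deg x = 0} →₀ ResidueField A) :=
    Finsupp.mapRange.linearMap (Algebra.linearMap A (ResidueField A)) ∘ₗ
      Finsupp.lcomapDomain Subtype.val Subtype.val_injective
  have hg : Function.Surjective g :=
    ((maximalIdeal A).toCotangent_surjective).comp P.surjective
  have hh : Function.Surjective h := by
    intro f
    induction f using Finsupp.induction_linear with
    | zero => exact ⟨0, map_zero h⟩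
    | add a b ha hb =>
      obtain ⟨a, rfl⟩ := ha
      obtain ⟨b, rfl⟩ := hb
      exact ⟨a + b, map_add h a b⟩
    | single x c =>
      obtain ⟨a, rfl⟩ := residue_surjective c
      refine ⟨.single x.1 a, ?_⟩
      ext y
      change residue A (Finsupp.single x.1 a y.1) = _
      by_cases hxy : x = y
      · subst hxy
        rw [Finsupp.single_eq_same, Finsupp.single_eq_same]
      · rw [Finsupp.single_eq_of_ne (Ne.symm hxy),
          Finsupp.single_eq_of_ne (fun h => hxy (Subtype.ext h.symm)), map_zero]
  have hker : LinearMap.ker g = LinearMap.ker h := by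
    ext z
    have h1 : z ∈ LinearMap.ker h ↔ ∀ x, deg x = 0 → z x ∈ maximalIdeal A := by
      rw [LinearMap.mem_ker, Finsupp.ext_iff, Subtype.forall]
      exact forall₂_congr fun x hx => residue_eq_zero_iff _
    have h2 : z ∈ LinearMap.ker g ↔
        P.ε z ∈ maximalIdeal A • (⊤ : Submodule A (maximalIdeal A)) := by
      rw [LinearMap.mem_ker, Submodule.mem_smul_top_iff, smul_eq_mul, ← pow_two]
      exact (maximalIdeal A).toCotangent_eq_zero _
    rw [h1, h2]
    constructor
    · intro hz
      rw [← LinearMap.range_eq_top.2 P.surjective, ← Submodule.map_top, ← Submodule.map_smul''] at hz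
      obtain ⟨a, ha, haz⟩ := hz
      have ha' : ∀ y, a y ∈ maximalIdeal A := fun y => by
        refine Submodule.smul_induction_on (p := fun a => a y ∈ maximalIdeal A) ha ?_ ?_
        · intro r hr n _
          exact Ideal.mul_mem_right _ _ hr
        · intro b c hb hc
          exact add_mem hb hc
      -- The degree 0 part of `z - a` has augmentation zero, so it is a boundary, and boundaries
      -- have coordinates in the maximal ideal.
      obtain ⟨w, hw⟩ := P.exact ((z - a).filter fun x => deg x = 0) (P.d_filter_zero _)
        (by rw [P.ε_filter_zero, map_sub, haz, sub_self])
      intro x hx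
      have := P.d_apply_mem w x
      rw [hw, Finsupp.filter_apply_pos (fun x => deg x = 0) _ hx, Finsupp.sub_apply] at this
      simpa using add_mem this (ha' x)
    · intro hz
      rw [← P.ε_filter_zero, ← LinearMap.range_eq_top.2 P.surjective, ← Submodule.map_top,
        ← Submodule.map_smul'']
      refine Submodule.mem_map_of_mem
        (Module.Basis.mem_ideal_smul_top Finsupp.basisSingleOne _ _ fun y => ?_)
      change (z.filter fun x => deg x = 0) y ∈ _
      by_cases hy : deg y = 0
      · rw [Finsupp.filter_apply_pos (fun x => deg x = 0) _ hy]
        exact hz y hy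
      · rw [Finsupp.filter_apply_neg (fun x => deg x = 0) _ hy]
        exact zero_mem _
  exact finrank_residueField_eq (((g.quotKerEquivOfSurjective hg).symm ≪≫ₗ
    Submodule.quotEquivOfEq _ _ hker) ≪≫ₗ h.quotKerEquivOfSurjective hh)

end MinimalResolution

/-- The embedding dimension is the first Betti number of the residue field. -/
theorem edim_eq_betti {A : Type u} [CommRing A] [IsLocalRing A] [IsNoetherianRing A]
    (Y : ModuleCat.{u} A) (π : A →ₗ[A] Y) (hπ : Function.Surjective π)
    (hker : ∀ a, π a = 0 ↔ a ∈ maximalIdeal A) : betti A Y 0 = 1 ∧ betti A Y 1 = edim A := by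
  obtain ⟨κ, deg, ⟨P⟩⟩ := exists_minimalResolution A (maximalIdeal A)
  -- Augmenting shifts degrees by one, so `β_1(k) = β_0(𝔪)`. Allowing any quotient `Y` by `𝔪` covers
  -- the residue field of `R` seen over `R ⋉ M`.
  let Q := P.augment (maximalIdeal A).subtype Subtype.val_injective (fun x => x.2) π hπ
    (fun a => (hker a).trans ⟨fun h => ⟨⟨a, h⟩, rfl⟩, fun ⟨x, hx⟩ => hx ▸ x.2⟩)
  rw [Q.betti_eq, Q.betti_eq, P.edim_eq, MinimalResolution.card_augment_zero,
    MinimalResolution.card_augment_succ]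
  exact ⟨rfl, rfl⟩

/-! ### Idealizations -/

section Idealization

variable (R M : Type u) [CommRing R] [IsLocalRing R] [IsNoetherianRing R]
    [AddCommGroup M] [Module R M] [Module Rᵐᵒᵖ M] [IsCentralScalar R M] [Module.Finite R M]

omit [IsLocalRing R] in
theorem isNoetherianRing_idealization : IsNoetherianRing (TrivSqZeroExt R M) := by
  have : Module.Finite R (TrivSqZeroExt R M) := inferInstanceAs (Module.Finite R (R × M))
  exact IsNoetherianRing.of_finite R _

/-- The projection `R ⋉ M → R` as a map of modules over `R ⋉ M`. -/
noncomputable def idealizationFst : TrivSqZeroExt R M →ₗ[TrivSqZeroExt R M]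
    overIdealization R M R where
  toFun a := a.fst
  map_add' _ _ := rfl
  map_smul' _ _ := rfl

/-- The inclusion `M → R ⋉ M` as a map of modules over `R ⋉ M`. -/
noncomputable def idealizationInr : overIdealization R M M →ₗ[TrivSqZeroExt R M]
    TrivSqZeroExt R M where
  toFun m := TrivSqZeroExt.inr (show M from m)
  map_add' a b := TrivSqZeroExt.inr_add R (show M from a) (show M from b)
  map_smul' a m := by
    change M at m
    change TrivSqZeroExt.inr (a.fst • m) = a * TrivSqZeroExt.inr m
    ext <;> simp

theorem exists_minimalResolution_idealization : ∃ (τ : Type) (q : τ → ℕ),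
    Nonempty (MinimalResolution (TrivSqZeroExt R M) (overIdealization R M R) τ q) := by
  have := isNoetherianRing_idealization R M
  have : Module.Finite (TrivSqZeroExt R M) (overIdealization R M R) :=
    Module.Finite.of_surjective (idealizationFst R M) fun r => ⟨TrivSqZeroExt.inl r, rfl⟩
  exact exists_minimalResolution _ _

variable {R M} in
/-- A minimal resolution of `N` over the idealization `R ⋉ M`, from resolutions of `N` over `R` and
of `R` over `R ⋉ M`. -/
noncomputable def totalIdealization {N : Type u} [AddCommGroup N] [Module R N] {κ τ : Type}
    {p : κ → ℕ} {q : τ → ℕ} (F : MinimalResolution R N κ p)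
    (D : MinimalResolution (TrivSqZeroExt R M) (overIdealization R M R) τ q) :
    MinimalResolution (TrivSqZeroExt R M) (overIdealization R M N) (κ × τ)
      (fun z => p z.1 + q z.2) :=
  -- These are the actions of `overIdealization`, put on the plain types `R` and `N` as `total`
  -- requires.
  letI : Module (TrivSqZeroExt R M) R :=
    Module.compHom R (TrivSqZeroExt.fstHom R R M).toRingHom
  letI : Module (TrivSqZeroExt R M) N :=
    Module.compHom N (TrivSqZeroExt.fstHom R R M).toRingHom
  MinimalResolution.total (A := TrivSqZeroExt R M) (R := R) (N := N)
    (ρ := (TrivSqZeroExt.fstHom R R M).toRingHom) (fun _ => rfl) (fun _ _ => rfl) F D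
    (fun _ _ => rfl)

/-- The factorization `P_N^A = P_N^R * P_R^A`, coefficient by coefficient. -/
theorem betti_idealization (N : Type u) [AddCommGroup N] [Module R N] [Module.Finite R N] (i : ℕ) :
    betti (TrivSqZeroExt R M) (overIdealization R M N) i =
      ∑ j ∈ Finset.HasAntidiagonal.antidiagonal i, betti R (.of R N) j.1 *
        betti (TrivSqZeroExt R M) (overIdealization R M R) j.2 := by
  obtain ⟨τ, q, ⟨D⟩⟩ := exists_minimalResolution_idealization R M
  obtain ⟨κ, p, ⟨F⟩⟩ := exists_minimalResolution R N
  have hF : ∀ i, betti R (.of R N) i = Nat.card {x // p x = i} :=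
    fun i => MinimalResolution.betti_eq (X := .of R N) F i
  rw [(totalIdealization F D).betti_eq, (card_prod_deg p q F.finite_deg D.finite_deg i).2]
  exact Finset.sum_congr rfl fun j _ => by rw [hF, D.betti_eq]

/-- The relation `P_R^A = 1 + t * P_M^A`: the ideal `M` of `R ⋉ M` is the kernel of the projection
and carries the action through `R`. -/
theorem betti_idealization_base :
    betti (TrivSqZeroExt R M) (overIdealization R M R) 0 = 1 ∧
    ∀ i, betti (TrivSqZeroExt R M) (overIdealization R M R) (i + 1) =
      betti (TrivSqZeroExt R M) (overIdealization R M M) i := by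
  obtain ⟨τ, q, ⟨D⟩⟩ := exists_minimalResolution_idealization R M
  obtain ⟨κ, p, ⟨F⟩⟩ := exists_minimalResolution R M
  let P := totalIdealization F D
  let Q := P.augment (idealizationInr R M) TrivSqZeroExt.inr_injective (fun m => by
      rw [mem_maximalIdeal, mem_nonunits_iff, TrivSqZeroExt.isUnit_iff_isUnit_fst]
      exact not_isUnit_zero) (idealizationFst R M) (fun r => ⟨TrivSqZeroExt.inl r, rfl⟩)
    (fun a => ⟨fun h => ⟨a.snd, TrivSqZeroExt.ext (Eq.symm h) rfl⟩, fun ⟨m, hm⟩ => hm ▸ rfl⟩)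
  refine ⟨?_, fun i => ?_⟩
  · rw [Q.betti_eq, MinimalResolution.card_augment_zero]
  · rw [Q.betti_eq, P.betti_eq, MinimalResolution.card_augment_succ]

theorem edim_idealization :
    betti (TrivSqZeroExt R M) (overIdealization R M (ResidueField R)) 1 =
      edim (TrivSqZeroExt R M) := by
  have := isNoetherianRing_idealization R M
  let π : TrivSqZeroExt R M →ₗ[TrivSqZeroExt R M] overIdealization R M (ResidueField R) :=
    { toFun := fun a => residue R a.fst
      map_add' := fun a b => map_add (residue R) a.fst b.fst
      map_smul' := fun a b => by
        change residue R (a.fst * b.fst) = a.fst • residue R b.fst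
        rw [map_mul, Algebra.smul_def, ResidueField.algebraMap_eq] }
  refine (edim_eq_betti _ π (fun x => ?_) fun a => ?_).2
  · obtain ⟨r, hr⟩ := residue_surjective (R := R) x
    exact ⟨TrivSqZeroExt.inl r, hr⟩
  · rw [mem_maximalIdeal, mem_nonunits_iff, TrivSqZeroExt.isUnit_iff_isUnit_fst,
      ← mem_nonunits_iff, ← mem_maximalIdeal]
    exact residue_eq_zero_iff a.fst

end Idealization

end LocalBetti

/-! ### Low degrees and the lower bound -/

theorem proposition4p2 (R M N : Type u) [CommRing R] [IsLocalRing R] [IsNoetherianRing R]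
    [AddCommGroup M] [Module R M] [Module Rᵐᵒᵖ M] [IsCentralScalar R M] [Module.Finite R M]
    [AddCommGroup N] [Module R N] [Module.Finite R N] :
    betti (TrivSqZeroExt R M) (overIdealization R M N) 0 = betti R (.of R N) 0 ∧
    betti (TrivSqZeroExt R M) (overIdealization R M N) 1 =
      betti R (.of R N) 0 * betti R (.of R M) 0 + betti R (.of R N) 1 ∧
    edim (TrivSqZeroExt R M) = betti R (.of R M) 0 + edim R ∧
    betti (TrivSqZeroExt R M) (overIdealization R M N) 2 =
      betti R (.of R N) 0 * betti R (.of R M) 0 ^ 2 +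
      betti R (.of R N) 0 * betti R (.of R M) 1 +
      betti R (.of R M) 0 * betti R (.of R N) 1 + betti R (.of R N) 2 ∧
    -- with the convention that the Betti number in degree `-1` is zero
    ∀ i : ℕ, betti R (.of R M) 0 * (if i = 0 then 0 else betti R (.of R N) (i - 1)) +
      betti R (.of R N) i ≤ betti (TrivSqZeroExt R M) (overIdealization R M N) i := by
  obtain ⟨t0, ts⟩ := betti_idealization_base R M
  have t1 : betti (TrivSqZeroExt R M) (overIdealization R M R) 1 = betti R (.of R M) 0 := by
    rw [ts 0, betti_idealization]
    simp [t0]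
  have t2 : betti (TrivSqZeroExt R M) (overIdealization R M R) 2 =
      betti R (.of R M) 0 ^ 2 + betti R (.of R M) 1 := by
    rw [ts 1, betti_idealization, Finset.Nat.sum_antidiagonal_eq_sum_range_succ_mk]
    simp [Finset.sum_range_succ, t0, t1, pow_two]
  -- Kept general in `N`, since the embedding dimension needs the case of the residue field.
  have h1 : ∀ (N : Type u) [AddCommGroup N] [Module R N] [Module.Finite R N],
      betti (TrivSqZeroExt R M) (overIdealization R M N) 1 =
        betti R (.of R N) 0 * betti R (.of R M) 0 + betti R (.of R N) 1 := by
    intro N _ _ _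
    rw [betti_idealization, Finset.Nat.sum_antidiagonal_eq_sum_range_succ_mk]
    simp [Finset.sum_range_succ, t0, t1]
  refine ⟨?_, h1 N, ?_, ?_, fun i => ?_⟩
  · rw [betti_idealization]
    simp [t0]
  · have hk := edim_eq_betti (A := R) (.of R (IsLocalRing.ResidueField R))
      (Algebra.linearMap R _) IsLocalRing.residue_surjective IsLocalRing.residue_eq_zero_iff
    rw [← edim_idealization, h1, hk.1, hk.2, one_mul]
  · rw [betti_idealization, Finset.Nat.sum_antidiagonal_eq_sum_range_succ_mk]
    simp [Finset.sum_range_succ, t0, t1, t2]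
    ring
  · rw [betti_idealization]
    cases i with
    | zero => simp [t0]
    | succ i =>
      -- These two terms of the convolution have known second factors `β_0^R(M)` and `1`; the others
      -- are nonnegative.
      have hsub : ({(i, 1), (i + 1, 0)} : Finset (ℕ × ℕ)) ⊆
          Finset.HasAntidiagonal.antidiagonal (i + 1) := by
        intro j hj
        rw [Finset.HasAntidiagonal.mem_antidiagonal]
        rcases Finset.mem_insert.1 hj with rfl | hj
        · rfl
        · rw [Finset.mem_singleton.1 hj]
          rfl
      refine le_trans (le_of_eq ?_) (Finset.sum_le_sum_of_subset hsub)
      rw [Finset.sum_pair (by simp), t0, t1]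
      simp [mul_comm]
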